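/- All graphs are finite, simple and have at least $3$ vertices. For a connected graph $G=(V,E)$ let $\mathbf{L}$ be its normalized Laplacian, acting on functions $f:V\to\mathbb{R}$ by $$\mathbf{L}f(v)=f(v)-\frac{1}{\deg v}\sum_{w\sim v}f(w),$$ and let $\mathrm{gap}(G)=\min_{\lambda\in\sigma(\mathbf{L})}|\lambda-1|$, where $\sigma(\mathbf{L})$ is the spectrum of $\mathbf{L}$. Let $\mathcal{G}_{=2}$ be the family of connected $2$-regular graphs and $\mathcal{G}_{\ge 2}$ the family of connected graphs with minimum degree at least $2$. For a family $\mathcal{G}'$ of connected graphs put $\mathbf{gap}(\mathcal{G}')=\sup_{G\in\mathcal{G}'}\mathrm{gap}(G)$ and $\mathbf{Extreme}(\mathcal{G}')=\{G\in\mathcal{G}':\mathrm{gap}(G)=\mathbf{gap}(\mathcal{G}')\}$. The friendship graph with $m\ge 1$ triangles consists of $m$ triangles that share one common vertex and are otherwise disjoint. The book graph with $m\ge 2$ pages consists of two distinct vertices $x,y$ joined by $m$ internally disjoint paths of length $3$: its vertices are $x,y,a_1,b_1,\dots,a_m,b_m$ and its edges are $xa_i$, $a_ib_i$, $b_iy$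 for $1\le i\le m$. Theorem. One has $$\mathbf{gap}(\mathcal{G}_{=2})=\mathbf{gap}(\mathcal{G}_{\ge 2})=\tfrac12 .$$ Moreover, up to isomorphism, $\mathbf{Extreme}(\mathcal{G}_{=2})$ consists exactly of the triangle and the hexagon (the cycles of length $3$ and $6$), and $\mathbf{Extreme}(\mathcal{G}_{\ge 2})$ consists exactly of the friendship graphs with $m\ge 1$ triangles and the book graphs with $m\ge 2$ pages. -/

import Mathlib

universe u

namespace SpectralGap

open Classical in
/-- The normalized Laplacian of a finite simple graph, as an operator on real functions on the
vertices: `(L f)(v) = f(v) - (1 / deg v) * ∑_{w ∼ v} f(w)`. -/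
noncomputable def normalizedLaplacian {V : Type u} [Fintype V] (G : SimpleGraph V) :
    Module.End ℝ (V → ℝ) where
  toFun f v := f v - (1 / (G.degree v : ℝ)) * ∑ w ∈ G.neighborFinset v, f w
  map_add' f g := by
    ext v
    simp only [Pi.add_apply, Finset.sum_add_distrib]
    ring
  map_smul' c f := by
    ext v
    simp only [Pi.smul_apply, smul_eq_mul, RingHom.id_apply, ← Finset.mul_sum]
    ring

/-- The spectral gap from `1`: the minimum of `|μ - 1|` over the spectrum of the normalized
Laplacian (it is attained for every graph without isolated vertices, see `isLeast_gap`). -/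
noncomputable def gap {V : Type u} [Fintype V] (G : SimpleGraph V) : ℝ :=
  sInf ((fun μ : ℝ => |μ - 1|) '' spectrum ℝ (normalizedLaplacian G))

/-- The infimum in the definition of `gap` is a minimum. -/
theorem isLeast_gap {V : Type u} [Fintype V] [Nonempty V] (G : SimpleGraph V)
    (hG : ∀ v, ∃ w, G.Adj v w) :
    IsLeast ((fun μ : ℝ => |μ - 1|) '' spectrum ℝ (normalizedLaplacian G)) (gap G) := by
  classical
  have hfin : (spectrum ℝ (normalizedLaplacian G)).Finite := Module.End.finite_spectrum _
  have h0 : (0 : ℝ) ∈ spectrum ℝ (normalizedLaplacian G) := by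
    refine Module.End.HasEigenvalue.mem_spectrum ?_
    refine Module.End.hasEigenvalue_of_hasEigenvector (x := fun _ => (1 : ℝ)) ⟨?_, ?_⟩
    · rw [Module.End.mem_eigenspace_iff]
      ext v
      obtain ⟨w, hw⟩ := hG v
      have hd := (G.degree_pos_iff_exists_adj v).2 ⟨w, hw⟩
      have hd' : (G.degree v : ℝ) ≠ 0 := by exact_mod_cast hd.ne'
      simp only [normalizedLaplacian, LinearMap.coe_mk, AddHom.coe_mk, Finset.sum_const,
        nsmul_eq_mul, mul_one, zero_smul, Pi.zero_apply, SimpleGraph.card_neighborFinset_eq_degree]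
      convert sub_self (1 : ℝ) using 2
      convert one_div_mul_cancel hd' using 3
    · intro h
      obtain ⟨v⟩ := ‹Nonempty V›
      exact one_ne_zero (congrFun h v)
  exact (Set.Nonempty.csInf_mem (Set.Nonempty.image _ ⟨0, h0⟩) (hfin.image _)).elim
    fun x hx => ⟨⟨x, hx⟩, fun y hy => csInf_le (hfin.image _).bddBelow hy⟩

/-- A finite simple graph together with its vertex set. -/
structure FinGraph : Type (u + 1) where
  V : Type u
  [fintypeV : Fintype V]
  graph : SimpleGraph V

attribute [instance] FinGraph.fintypeV

/-- The family of all connected graphs with at least three vertices. -/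
def connectedGraphs : Set FinGraph.{u} :=
  {G | G.graph.Connected ∧ 3 ≤ Fintype.card G.V}

open Classical in
/-- Connected graphs (on at least three vertices) of minimum degree at least `d`. -/
def minDegreeGE (d : ℕ) : Set FinGraph.{u} :=
  {G | G ∈ connectedGraphs ∧ ∀ v, d ≤ G.graph.degree v}

open Classical in
/-- Connected `d`-regular graphs (on at least three vertices). -/
def regularGraphs (d : ℕ) : Set FinGraph.{u} :=
  {G | G ∈ connectedGraphs ∧ ∀ v, G.graph.degree v = d}

/-- The set of the gaps from `1` of the members of a family of graphs. -/
def gapValues (𝒢 : Set FinGraph.{u}) : Set ℝ := (fun G : FinGraph.{u} => gap G.graph) '' 𝒢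

/-- The supremum of the gap from `1` over a family of graphs. -/
noncomputable def supGap (𝒢 : Set FinGraph.{u}) : ℝ := sSup (gapValues 𝒢)

/-- The extremal graphs of a family: its members whose gap is the supremum over the family. -/
def extremalGraphs (𝒢 : Set FinGraph.{u}) : Set FinGraph.{u} :=
  {G | G ∈ 𝒢 ∧ gap G.graph = supGap 𝒢}

/-- The friendship graph: `m` triangles with one common vertex `none` and no other common
vertices; the `i`-th triangle is `none`, `(i, false)`, `(i, true)`. -/
def friendshipGraph (m : ℕ) : SimpleGraph (Option (Fin m × Bool)) where
  Adj
    | none, none => False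
    | none, some _ => True
    | some _, none => True
    | some p, some q => p.1 = q.1 ∧ p.2 ≠ q.2
  symm := ⟨by
    rintro (_ | p) (_ | q) h
    · exact h
    · trivial
    · trivial
    · exact ⟨h.1.symm, h.2.symm⟩⟩
  loopless := ⟨by
    rintro (_ | p) h
    · exact h
    · exact h.2 rfl⟩

/-- The book graph: two hubs `inl false`, `inl true` joined by `m` internally disjoint paths of
length three; the `i`-th path is `inl false`, `inr (i, false)`, `inr (i, true)`, `inl true`. -/
def bookGraph (m : ℕ) : SimpleGraph (Bool ⊕ (Fin m × Bool)) where
  Adj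
    | .inl _, .inl _ => False
    | .inl s, .inr q => s = q.2
    | .inr p, .inl t => p.2 = t
    | .inr p, .inr q => p.1 = q.1 ∧ p.2 ≠ q.2
  symm := ⟨by
    rintro (s | p) (t | q) h
    · exact h
    · exact Eq.symm h
    · exact Eq.symm h
    · exact ⟨h.1.symm, h.2.symm⟩⟩
  loopless := ⟨by
    rintro (s | p) h
    · exact h
    · exact h.2 rfl⟩

end SpectralGap

/-! With κ = 1 - μ, the gap is the least |κ| over the eigenvalues of the walk operator D⁻¹A. Hence
gap ≥ 1/2 makes A D⁻¹ A - D/4 positive semidefinite. Its off-diagonal entries sum 1/deg over common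
neighbours, and its diagonal entries are the sums of 1/deg w - 1/4 over neighbours w. Minimum degree
two keeps the diagonal small, so the 2×2 principal minors are very restrictive.

They first produce two adjacent vertices of degree two (`exists_adj_degree_two`). On a path w, u,
u', z with inner degrees two, the minors hold with equality, so all neighbours of w have degree two
(`path_ends`). Two neighbours u, v of such a hub give a singular minor
(`equality_of_two_neighbors`). Then e_u - e_v lies in the kernel, so every other vertex has the same
common weight with u as with v (`commonWeight_eq_of_excess_eq`). This carries the structure seen at
one neighbour of w to all of them and leaves only friendship and book graphs.

Conversely those graphs have gap exactly 1/2, by direct solution of the eigenvalue equations. No gap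
can therefore exceed 1/2, since such a graph would already be in the classification. The regular
case keeps the members whose hubs have degree two. -/

namespace SpectralGap

/-! ### Walk eigenvalues and the quadratic form of the squared walk operator. -/

section Spectral

open scoped Classical

variable {V : Type u} [Fintype V] {G : SimpleGraph V}

/-- `f` is an eigenfunction of the random walk operator `D⁻¹ A` for the eigenvalue `κ`. -/
def IsWalkEigen (G : SimpleGraph V) (κ : ℝ) (f : V → ℝ) : Prop :=
  f ≠ 0 ∧ ∀ v, ∑ w ∈ G.neighborFinset v, f w = κ * G.degree v * f v

theorem mem_spectrum_iff (hG : ∀ v, 0 < G.degree v) (μ : ℝ) :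
    μ ∈ spectrum ℝ (normalizedLaplacian G) ↔ ∃ f, IsWalkEigen G (1 - μ) f := by
  rw [← Module.End.hasEigenvalue_iff_mem_spectrum]
  have key : ∀ f : V → ℝ, normalizedLaplacian G f = μ • f ↔
      ∀ v, ∑ w ∈ G.neighborFinset v, f w = (1 - μ) * G.degree v * f v := by
    intro f
    rw [funext_iff]
    refine forall_congr' fun v => ?_
    have hd : (G.degree v : ℝ) ≠ 0 := by exact_mod_cast (hG v).ne'
    simp only [normalizedLaplacian, LinearMap.coe_mk, AddHom.coe_mk, Pi.smul_apply, smul_eq_mul]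
    constructor
    · intro h
      field_simp at h
      linarith
    · intro h
      rw [h]
      field_simp
      ring
  constructor
  · intro h
    obtain ⟨f, hf⟩ := h.exists_hasEigenvector
    exact ⟨f, hf.2, (key f).1 (Module.End.mem_eigenspace_iff.1 hf.1)⟩
  · rintro ⟨f, hf0, hf⟩
    exact Module.End.hasEigenvalue_of_hasEigenvector (x := f)
      ⟨Module.End.mem_eigenspace_iff.2 ((key f).2 hf), hf0⟩

theorem le_gap_iff [Nonempty V] (hG : ∀ v, 0 < G.degree v) (c : ℝ) :
    c ≤ gap G ↔ ∀ κ f, IsWalkEigen G κ f → c ≤ |κ| := by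
  have h := (isLeast_gap G fun v => (G.degree_pos_iff_exists_adj v).1 (hG v)).isGLB
  rw [le_isGLB_iff h, mem_lowerBounds, Set.forall_mem_image]
  constructor
  · intro H κ f hf
    have := H ((mem_spectrum_iff hG (1 - κ)).2 ⟨f, by simpa using hf⟩)
    simpa using this
  · intro H μ hμ
    obtain ⟨f, hf⟩ := (mem_spectrum_iff hG μ).1 hμ
    rw [abs_sub_comm]
    exact H _ f hf

theorem gap_le_of_isWalkEigen [Nonempty V] (hG : ∀ v, 0 < G.degree v) {κ : ℝ} {f : V → ℝ}
    (hf : IsWalkEigen G κ f) : gap G ≤ |κ| :=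
  (le_gap_iff hG _).1 le_rfl κ f hf

theorem gap_congr {W : Type*} [Fintype W] [Nonempty V] {H : SimpleGraph W} (e : G ≃g H)
    (hG : ∀ v, 0 < G.degree v) : gap G = gap H := by
  have : Nonempty W := ⟨e (Classical.arbitrary V)⟩
  have hdeg : ∀ v, H.degree (e v) = G.degree v := fun v => by
    convert e.degree_eq v
  have hH : ∀ w, 0 < H.degree w := fun w => by
    obtain ⟨v, rfl⟩ := e.surjective w
    rw [hdeg]; exact hG v
  have hsum : ∀ (f : W → ℝ) (v : V),
      ∑ w ∈ H.neighborFinset (e v), f w = ∑ w ∈ G.neighborFinset v, f (e w) := by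
    intro f v
    refine (Finset.sum_bij (fun w _ => e w) ?_ ?_ ?_ ?_).symm
    · intro w hw
      simpa [e.map_adj_iff] using hw
    · intro a _ b _ h
      exact e.injective h
    · intro b hb
      obtain ⟨a, rfl⟩ := e.surjective b
      exact ⟨a, by simpa [e.map_adj_iff] using hb, rfl⟩
    · intro _ _; rfl
  have key : ∀ κ f, IsWalkEigen H κ f ↔ IsWalkEigen G κ (f ∘ e) := by
    intro κ f
    have h0 : f ≠ 0 ↔ f ∘ e ≠ 0 := by
      rw [Ne, Ne, not_iff_not]
      constructor
      · rintro rfl; rfl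
      · intro h
        ext w
        obtain ⟨v, rfl⟩ := e.surjective w
        exact congrFun h v
    refine and_congr h0 ?_
    rw [← e.surjective.forall (p := fun w =>
      ∑ x ∈ H.neighborFinset w, f x = κ * H.degree w * f w) |>.symm]
    refine forall_congr' fun v => ?_
    rw [hsum, hdeg]
    rfl
  apply le_antisymm
  · rw [le_gap_iff hH]
    intro κ f hf
    exact gap_le_of_isWalkEigen hG ((key κ f).1 hf)
  · rw [le_gap_iff hG]
    intro κ f hf
    refine gap_le_of_isWalkEigen hH (f := f ∘ e.symm) ((key κ _).2 ?_)
    convert hf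
    ext v
    simp

/-- A lower bound for the gap is a lower bound for the square of the random walk operator. -/
theorem sq_mul_sum_le_of_le_gap [Nonempty V] (hG : ∀ v, 0 < G.degree v) {c : ℝ} (hc : 0 ≤ c)
    (h : c ≤ gap G) (f : V → ℝ) :
    c ^ 2 * ∑ v, G.degree v * f v ^ 2 ≤
      ∑ w, 1 / (G.degree w : ℝ) * (∑ v ∈ G.neighborFinset w, f v) ^ 2 := by
  set s : V → ℝ := fun v => √(G.degree v : ℝ) with hs
  have hd : ∀ v, (0 : ℝ) < G.degree v := fun v => by exact_mod_cast hG v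
  have hs0 : ∀ v, 0 < s v := fun v => Real.sqrt_pos.2 (hd v)
  have hss : ∀ v, s v ^ 2 = G.degree v := fun v => Real.sq_sqrt (hd v).le
  -- The symmetric matrix D^(-1/2) A D^(-1/2) is conjugate to D⁻¹A; dividing its eigenvectors by `s`
  -- gives walk eigenfunctions.
  let N : Matrix V V ℝ := fun u v => if G.Adj u v then 1 / (s u * s v) else 0
  have hN : N.IsHermitian := by
    refine Matrix.IsHermitian.ext fun u v => ?_
    simp [N, G.adj_comm u v, mul_comm]
  have hmul : ∀ (x : V → ℝ) (u : V),
      (N.mulVec x) u = 1 / s u * ∑ v ∈ G.neighborFinset u, x v / s v := by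
    intro x u
    rw [Finset.mul_sum, SimpleGraph.neighborFinset_eq_filter, Finset.sum_filter]
    simp only [Matrix.mulVec, dotProduct, N]
    refine Finset.sum_congr rfl fun v _ => ?_
    split_ifs
    · have := (hs0 u).ne'; have := (hs0 v).ne'
      field_simp
    · simp
  let b := hN.eigenvectorBasis
  have heig : ∀ j, c ≤ |hN.eigenvalues j| := by
    intro j
    have hj := hN.mulVec_eigenvectorBasis j
    refine (le_gap_iff hG c).1 h _ (fun v => b j v / s v) ⟨?_, ?_⟩
    · intro h0
      refine b.toBasis.ne_zero j ?_
      ext v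
      have := congrFun h0 v
      simpa [(hs0 v).ne'] using this
    · intro v
      have h1 := congrFun hj v
      rw [hmul] at h1
      simp only [Pi.smul_apply, smul_eq_mul] at h1
      rw [← hss v]
      have := (hs0 v).ne'
      have h2 : ∑ w ∈ G.neighborFinset v, b j w / s w = s v * (hN.eigenvalues j * b j v) := by
        rw [← h1]
        field_simp
        rfl
      rw [h2]
      field_simp
  -- With x = D^(1/2) f, the two sides of the claim are c²‖x‖² and ‖Nx‖², compared below
  -- coordinatewise in the eigenbasis by Parseval.
  let x : EuclideanSpace ℝ V := WithLp.toLp 2 fun v => s v * f v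
  let y : EuclideanSpace ℝ V := WithLp.toLp 2 (N.mulVec x)
  have hin : ∀ j, inner ℝ (b j) y = hN.eigenvalues j * inner ℝ (b j) x := by
    intro j
    have hj := hN.mulVec_eigenvectorBasis j
    have hNT : N.transpose = N := by simpa [Matrix.IsHermitian] using hN
    simp only [EuclideanSpace.inner_eq_star_dotProduct, star_trivial]
    change (N.mulVec x.ofLp) ⬝ᵥ (b j).ofLp = _ * (x.ofLp ⬝ᵥ (b j).ofLp)
    rw [dotProduct_comm, Matrix.dotProduct_mulVec, ← Matrix.mulVec_transpose, hNT]
    change N.mulVec (hN.eigenvectorBasis j).ofLp ⬝ᵥ _ = _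
    rw [hj, smul_dotProduct, smul_eq_mul, dotProduct_comm]
  have hx : ‖x‖ ^ 2 = ∑ v, G.degree v * f v ^ 2 := by
    rw [EuclideanSpace.real_norm_sq_eq]
    refine Finset.sum_congr rfl fun v _ => ?_
    simp only [x]
    rw [mul_pow, hss]
  have hy : ‖y‖ ^ 2 = ∑ w, 1 / (G.degree w : ℝ) * (∑ v ∈ G.neighborFinset w, f v) ^ 2 := by
    rw [EuclideanSpace.real_norm_sq_eq]
    refine Finset.sum_congr rfl fun v _ => ?_
    simp only [y]
    rw [hmul, mul_pow, div_pow, one_pow, hss]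
    congr 2
    refine Finset.sum_congr rfl fun w _ => ?_
    have := (hs0 w).ne'
    simp only [x]
    field_simp
  rw [← hx, ← hy, ← b.sum_sq_norm_inner_right x, ← b.sum_sq_norm_inner_right y, Finset.mul_sum]
  refine Finset.sum_le_sum fun j _ => ?_
  rw [hin, norm_mul, mul_pow]
  gcongr
  exact heig j

end Spectral

/-! ### The matrix A D⁻¹ A - D/4 and its 2×2 minors. -/

section Weights

open scoped Classical

variable {V : Type u} [Fintype V] {G : SimpleGraph V}

/-- The `(u, v)` entry of `A D⁻¹ A`. -/
noncomputable def commonWeight (G : SimpleGraph V) (u v : V) : ℝ :=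
  ∑ w ∈ G.neighborFinset u ∩ G.neighborFinset v, 1 / (G.degree w : ℝ)

/-- The `u`-th diagonal entry of `A D⁻¹ A - D / 4`. -/
noncomputable def excess (G : SimpleGraph V) (u : V) : ℝ :=
  ∑ w ∈ G.neighborFinset u, (1 / (G.degree w : ℝ) - 1 / 4)

/-- The matrix `A D⁻¹ A - D / 4`. -/
noncomputable def excessMatrix (G : SimpleGraph V) : Matrix V V ℝ :=
  fun u v => if u = v then excess G u else commonWeight G u v

theorem commonWeight_comm (u v : V) : commonWeight G u v = commonWeight G v u := by
  rw [commonWeight, commonWeight, Finset.inter_comm]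

theorem excess_eq (u : V) : excess G u = commonWeight G u u - G.degree u / 4 := by
  simp only [excess, commonWeight, Finset.sum_sub_distrib, Finset.inter_self, Finset.sum_const,
    SimpleGraph.card_neighborFinset_eq_degree, nsmul_eq_mul]
  ring

theorem excessMatrix_apply (u v : V) : excessMatrix G u v =
    commonWeight G u v - if u = v then (G.degree u : ℝ) / 4 else 0 := by
  unfold excessMatrix
  split_ifs with h
  · subst h; exact excess_eq u
  · simp

theorem dotProduct_excessMatrix_mulVec (f : V → ℝ) : f ⬝ᵥ (excessMatrix G).mulVec f =
    ∑ w, 1 / (G.degree w : ℝ) * (∑ v ∈ G.neighborFinset w, f v) ^ 2 -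
      1 / 4 * ∑ v, G.degree v * f v ^ 2 := by
  have h1 : ∀ u v, commonWeight G u v = ∑ w, 1 / (G.degree w : ℝ) *
      ((if G.Adj w u then 1 else 0) * (if G.Adj w v then 1 else 0)) := by
    intro u v
    have : G.neighborFinset u ∩ G.neighborFinset v =
        Finset.univ.filter fun w => G.Adj w u ∧ G.Adj w v := by
      ext w
      simp [G.adj_comm w]
    rw [commonWeight, this, Finset.sum_filter]
    refine Finset.sum_congr rfl fun w _ => ?_
    by_cases hu : G.Adj w u <;> by_cases hv : G.Adj w v <;> simp [hu, hv]
  have h2 : ∀ w, ∑ v ∈ G.neighborFinset w, f v = ∑ v, (if G.Adj w v then 1 else 0) * f v := by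
    intro w
    rw [SimpleGraph.neighborFinset_eq_filter, Finset.sum_filter]
    simp
  have h3 : ∀ u, ∑ v, f u * ((if u = v then (G.degree u : ℝ) / 4 else 0) * f v) =
      1 / 4 * (G.degree u * f u ^ 2) := by
    intro u
    simp only [ite_mul, zero_mul, mul_ite, mul_zero, Finset.sum_ite_eq, Finset.mem_univ, if_true]
    ring
  simp only [dotProduct, Matrix.mulVec, excessMatrix_apply, Finset.mul_sum, sub_mul, mul_sub,
    Finset.sum_sub_distrib, h3]
  congr 1
  simp only [h1, h2, sq, Finset.mul_sum, Finset.sum_mul]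
  rw [Finset.sum_congr rfl fun u _ => Finset.sum_comm, Finset.sum_comm]
  refine Finset.sum_congr rfl fun w _ => Finset.sum_congr rfl fun u _ =>
    Finset.sum_congr rfl fun v _ => ?_
  ring

theorem excessMatrix_posSemidef
    (h : ∀ f : V → ℝ, 1 / 4 * ∑ v, G.degree v * f v ^ 2 ≤
      ∑ w, 1 / (G.degree w : ℝ) * (∑ v ∈ G.neighborFinset w, f v) ^ 2) :
    (excessMatrix G).PosSemidef := by
  refine Matrix.PosSemidef.of_dotProduct_mulVec_nonneg 
    (Matrix.IsHermitian.ext fun u v => ?_) fun f => ?_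
  · simp only [excessMatrix, star_trivial, commonWeight_comm u v, @eq_comm _ v u]
    split_ifs with h
    · rw [h]
    · rfl
  · rw [star_trivial, dotProduct_excessMatrix_mulVec]
    linarith [h f]

/-- The principal minor on u, v is nonnegative. This is the main source of degree constraints. -/
theorem sq_commonWeight_le (h : (excessMatrix G).PosSemidef) {u v : V} (huv : u ≠ v) :
    commonWeight G u v ^ 2 ≤ excess G u * excess G v := by
  have := (h.submatrix ![u, v]).det_nonneg
  rw [Matrix.det_fin_two] at this
  simp [excessMatrix, huv, huv.symm, commonWeight_comm v u] at this
  linarith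

/-- All four entries of the block on u, v agree, so the form vanishes at e_u - e_v. By
semidefiniteness this vector is in the kernel; row x of the kernel equation is the claim. -/
theorem commonWeight_eq_of_excess_eq (h : (excessMatrix G).PosSemidef) {u v : V} (huv : u ≠ v)
    (hu : excess G u = commonWeight G u v) (hv : excess G v = commonWeight G u v) {x : V}
    (hxu : x ≠ u) (hxv : x ≠ v) : commonWeight G x u = commonWeight G x v := by
  set f : V → ℝ := Pi.single u 1 - Pi.single v 1
  have h0 : star f ⬝ᵥ (excessMatrix G).mulVec f = 0 := by
    simp [f, Matrix.mulVec_sub, sub_dotProduct, excessMatrix, huv, huv.symm,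
      commonWeight_comm v u, hu, hv]
  have h1 := congrFun ((h.dotProduct_mulVec_zero_iff f).1 h0) x
  simp [f, Matrix.mulVec_sub, excessMatrix, hxu, hxv] at h1
  linarith

end Weights

/-! ### Degree constraints forced by semidefiniteness. -/

section LocalStructure

open scoped Classical

variable {V : Type u} [Fintype V] {G : SimpleGraph V}

theorem degree_eq_card (v : V) : G.degree v = (G.neighborFinset v).card :=
  (G.card_neighborFinset_eq_degree v).symm

theorem adj_of_neighborFinset_eq {u a b x : V} (h : G.neighborFinset u = {a, b}) :
    G.Adj u x ↔ x = a ∨ x = b := by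
  rw [← SimpleGraph.mem_neighborFinset, h]
  simp

theorem exists_neighborFinset_eq_pair {u w : V} (hu : G.degree u = 2) (huw : G.Adj u w) :
    ∃ x, x ≠ w ∧ G.neighborFinset u = {w, x} := by
  rw [degree_eq_card, Finset.card_eq_two] at hu
  obtain ⟨a, b, hab, h⟩ := hu
  rcases (adj_of_neighborFinset_eq h).1 huw with rfl | rfl
  · exact ⟨b, hab.symm, h⟩
  · exact ⟨a, hab, by rw [h, Finset.pair_comm]⟩

theorem degree_eq_two_of_neighborFinset {u a b : V} (hab : b ≠ a)
    (h : G.neighborFinset u = {a, b}) : G.degree u = 2 := by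
  rw [degree_eq_card, h, Finset.card_pair hab.symm]

theorem excess_eq_of_neighborFinset {u a b : V} (hab : b ≠ a) (h : G.neighborFinset u = {a, b}) :
    excess G u = 1 / (G.degree a : ℝ) + 1 / (G.degree b : ℝ) - 1 / 2 := by
  rw [excess, h, Finset.sum_pair hab.symm]
  ring

theorem le_commonWeight {u v w : V} (hu : G.Adj u w) (hv : G.Adj v w) :
    1 / (G.degree w : ℝ) ≤ commonWeight G u v :=
  Finset.single_le_sum (f := fun w => 1 / (G.degree w : ℝ)) (fun _ _ => by positivity)
    (by simp [hu, hv])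

theorem add_le_commonWeight {u v w x : V} (hu : G.Adj u w) (hv : G.Adj v w) (hux : G.Adj u x)
    (hvx : G.Adj v x) (hwx : w ≠ x) :
    1 / (G.degree w : ℝ) + 1 / (G.degree x : ℝ) ≤ commonWeight G u v := by
  rw [← Finset.sum_pair (f := fun w => 1 / (G.degree w : ℝ)) hwx]
  refine Finset.sum_le_sum_of_subset_of_nonneg ?_ fun _ _ _ => by positivity
  intro y hy
  rcases Finset.mem_insert.1 hy with rfl | hy
  · simp [hu, hv]
  · rw [Finset.mem_singleton.1 hy]; simp [hux, hvx]

variable (hd : ∀ v, 2 ≤ G.degree v)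

include hd

theorem degree_cast_two_le (v : V) : (2 : ℝ) ≤ G.degree v := by
  exact_mod_cast hd v

theorem one_div_degree_pos (v : V) : 0 < 1 / (G.degree v : ℝ) := by
  have := degree_cast_two_le hd v
  positivity

theorem one_div_degree_le (v : V) : 1 / (G.degree v : ℝ) ≤ 1 / 2 := by
  have := degree_cast_two_le hd v
  gcongr

theorem excess_le (u : V) : excess G u ≤ G.degree u / 4 := by
  have : excess G u ≤ ∑ w ∈ G.neighborFinset u, (1 / 4 : ℝ) :=
    Finset.sum_le_sum fun w _ => by linarith [one_div_degree_le hd w]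
  simpa [div_eq_mul_inv] using this

/-- Equality case of `excess_le`: a summand reaches 1/2 - 1/4 only at a neighbour of degree two. -/
theorem degree_eq_two_of_le_excess {u : V} (h : (G.degree u : ℝ) / 4 ≤ excess G u) {x : V}
    (hx : G.Adj u x) : G.degree x = 2 := by
  by_contra hne
  have h3 : (2 : ℝ) < G.degree x := by exact_mod_cast lt_of_le_of_ne (hd x) (Ne.symm hne)
  have : excess G u < ∑ w ∈ G.neighborFinset u, (1 / 4 : ℝ) := by
    refine Finset.sum_lt_sum (fun w _ => by linarith [one_div_degree_le hd w])
      ⟨x, by simpa using hx, ?_⟩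
    have : 1 / (G.degree x : ℝ) < 1 / 2 := by gcongr
    linarith
  simp at this
  linarith

theorem exists_ne_adj (u x : V) : ∃ w, w ≠ x ∧ G.Adj u w := by
  obtain ⟨w, hw, hwx⟩ := Finset.exists_mem_ne (s := G.neighborFinset u)
    (by rw [← degree_eq_card]; exact hd u) x
  exact ⟨w, hwx, by simpa using hw⟩

variable (hM : (excessMatrix G).PosSemidef)

include hM

/-- A zero diagonal entry would annihilate its row, but minimum degree two gives a path u, w, v with
v ≠ u and hence a positive entry. -/
theorem excess_pos (u : V) : 0 < excess G u := by
  have hdiag : 0 ≤ excess G u := by simpa [excessMatrix] using hM.diag_nonneg (i := u)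
  obtain ⟨w, -, huw⟩ := exists_ne_adj hd u u
  obtain ⟨v, hvu, hwv⟩ := exists_ne_adj hd w u
  have h1 := sq_commonWeight_le hM hvu.symm
  have h2 := le_commonWeight huw hwv.symm
  have h3 := one_div_degree_pos hd w
  refine hdiag.lt_of_ne fun h0 => ?_
  rw [← h0, zero_mul] at h1
  nlinarith

/-- Two neighbours `u`, `v` of degree two of a vertex `w` give a vanishing minor. -/
theorem equality_of_two_neighbors {w u v u' v' : V} (huv : u ≠ v) (hu' : u' ≠ w) (hv' : v' ≠ w)
    (hu : G.neighborFinset u = {w, u'}) (hv : G.neighborFinset v = {w, v'}) :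
    G.degree u' = 2 ∧ G.degree v' = 2 ∧ u' ≠ v' ∧ excess G u = commonWeight G u v ∧
      excess G v = commonWeight G u v := by
  have hs := sq_commonWeight_le hM huv
  have hc := le_commonWeight ((adj_of_neighborFinset_eq hu).2 (.inl rfl))
    ((adj_of_neighborFinset_eq hv).2 (.inl rfl))
  have gu := excess_eq_of_neighborFinset hu' hu
  have gv := excess_eq_of_neighborFinset hv' hv
  have pu := excess_pos hd hM u
  have pv := excess_pos hd hM v
  have hw := one_div_degree_pos hd w
  have lu := one_div_degree_le hd u'
  have lv := one_div_degree_le hd v'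
  have hprod : (1 / (G.degree w : ℝ)) ^ 2 ≤ excess G u * excess G v :=
    le_trans (by gcongr) hs
  -- Both diagonal entries are at most 1/deg w because 1/deg u' and 1/deg v' are at most 1/2, while
  -- the off-diagonal entry is at least 1/deg w. The minor inequality thus forces equality
  -- throughout.
  have gu' : excess G u ≤ 1 / (G.degree w : ℝ) := by linarith
  have gv' : excess G v ≤ 1 / (G.degree w : ℝ) := by linarith
  have gu1 : excess G u = 1 / (G.degree w : ℝ) := by
    by_contra hne
    have := lt_of_le_of_ne gu' hne
    nlinarith
  have gv1 : excess G v = 1 / (G.degree w : ℝ) := by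
    by_contra hne
    have := lt_of_le_of_ne gv' hne
    nlinarith
  have hceq : commonWeight G u v = 1 / (G.degree w : ℝ) := by
    refine le_antisymm ?_ hc
    rw [gu1, gv1] at hs
    nlinarith
  have deg2 : ∀ x, 1 / (G.degree x : ℝ) = 1 / 2 → G.degree x = 2 := by
    intro x hx
    rw [one_div, one_div, inv_inj] at hx
    exact_mod_cast hx
  refine ⟨deg2 _ (by linarith), deg2 _ (by linarith), ?_, by rw [gu1, hceq], by rw [gv1, hceq]⟩
  -- A second common neighbour would raise the common weight strictly above 1/deg w.
  rintro rfl
  have := add_le_commonWeight ((adj_of_neighborFinset_eq hu).2 (.inl rfl))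
    ((adj_of_neighborFinset_eq hv).2 (.inl rfl)) ((adj_of_neighborFinset_eq hu).2 (.inr rfl))
    ((adj_of_neighborFinset_eq hv).2 (.inr rfl)) hu'.symm
  linarith [one_div_degree_pos hd u']

/-- As u' has degree two, the excess of u is exactly 1/deg w and the common weight of u and z is at
least 1/2; apply the minor on u, z. The case z = w, a triangle, is included. -/
theorem degree_div_four_le_excess {w u u' z : V} (huw : u' ≠ w) (huz : z ≠ u)
    (hu : G.neighborFinset u = {w, u'}) (hu' : G.neighborFinset u' = {u, z}) :
    (G.degree w : ℝ) / 4 ≤ excess G z := by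
  have hd' := degree_eq_two_of_neighborFinset huz hu'
  have gu := excess_eq_of_neighborFinset huw hu
  have hc := le_commonWeight ((adj_of_neighborFinset_eq hu).2 (.inr rfl))
    ((adj_of_neighborFinset_eq hu').2 (.inr rfl)).symm
  have hs := sq_commonWeight_le hM huz.symm
  have hw := degree_cast_two_le hd w
  rw [hd'] at gu hc
  push_cast at gu hc
  rw [add_sub_cancel_right] at gu
  have h4 : (1 : ℝ) / 4 ≤ 1 / G.degree w * excess G z := by
    rw [← gu]; nlinarith
  rw [div_mul_eq_mul_div, one_mul, le_div_iff₀ (by linarith)] at h4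
  linarith

/-- The end points of a path `w, u, u', z` whose inner vertices have degree two. -/
theorem path_ends {w u u' z : V} (huw : u' ≠ w) (huz : z ≠ u)
    (hu : G.neighborFinset u = {w, u'}) (hu' : G.neighborFinset u' = {u, z}) :
    G.degree z = G.degree w ∧ (∀ x, G.Adj w x → G.degree x = 2) ∧
      ∀ x, G.Adj z x → G.degree x = 2 := by
  have h1 := degree_div_four_le_excess hd hM huw huz hu hu'
  -- The reversed path gives the inequality with w and z exchanged; with `excess_le` the cycle of
  -- inequalities closes into equalities.
  have h2 := degree_div_four_le_excess hd hM huz.symm huw.symm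
    (by rw [hu', Finset.pair_comm]) (by rw [hu, Finset.pair_comm])
  have h3 := excess_le hd w
  have h4 := excess_le hd z
  refine ⟨?_, fun x => degree_eq_two_of_le_excess hd (by linarith),
    fun x => degree_eq_two_of_le_excess hd (by linarith)⟩
  have : (G.degree z : ℝ) = G.degree w := by linarith
  exact_mod_cast this

/-- If there are no two adjacent vertices of degree two, then every vertex has at most one
neighbour of degree two. -/
theorem eq_of_adj_degree_two (hno : ∀ u v, G.Adj u v → G.degree u = 2 → G.degree v ≠ 2)
    {w u v : V} (hu : G.Adj w u) (hv : G.Adj w v) (du : G.degree u = 2) (dv : G.degree v = 2) :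
    u = v := by
  by_contra huv
  obtain ⟨u', hu', eu⟩ := exists_neighborFinset_eq_pair du hu.symm
  obtain ⟨v', hv', ev⟩ := exists_neighborFinset_eq_pair dv hv.symm
  exact hno u u' ((adj_of_neighborFinset_eq eu).2 (.inr rfl)) du
    (equality_of_two_neighbors hd hM huv hu' hv' eu ev).1

/-- A neighbour of degree at least 3 contributes at most 1/3 - 1/4 = 1/12, and the at most one
neighbour of degree two contributes 1/6 more. -/
theorem twelve_mul_excess_le (hno : ∀ u v, G.Adj u v → G.degree u = 2 → G.degree v ≠ 2) (v : V) :
    12 * excess G v ≤ G.degree v + 2 := by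
  have hle : ∀ w, 1 / (G.degree w : ℝ) - 1 / 4 ≤ 1 / 12 + if G.degree w = 2 then 1 / 6 else 0 := by
    intro w
    split_ifs with h
    · rw [h]; norm_num
    · have h3 : (3 : ℝ) ≤ G.degree w := by
        exact_mod_cast lt_of_le_of_ne (hd w) (Ne.symm h)
      have : 1 / (G.degree w : ℝ) ≤ 1 / 3 := by gcongr
      linarith
  have hcard : ((G.neighborFinset v).filter fun w => G.degree w = 2).card ≤ 1 := by
    rw [Finset.card_le_one]
    intro a ha b hb
    simp only [Finset.mem_filter, SimpleGraph.mem_neighborFinset] at ha hb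
    exact eq_of_adj_degree_two hd hM hno ha.1 hb.1 ha.2 hb.2
  have hcard' : (((G.neighborFinset v).filter fun w => G.degree w = 2).card : ℝ) ≤ 1 := by
    exact_mod_cast hcard
  have := Finset.sum_le_sum fun w (_ : w ∈ G.neighborFinset v) => hle w
  rw [Finset.sum_add_distrib, ← Finset.sum_filter, Finset.sum_const, Finset.sum_const,
    nsmul_eq_mul, nsmul_eq_mul, ← degree_eq_card] at this
  rw [excess]
  linarith

theorem three_le_degree (hno : ∀ u v, G.Adj u v → G.degree u = 2 → G.degree v ≠ 2) (u : V) :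
    3 ≤ G.degree u := by
  by_contra! hlt
  have du : G.degree u = 2 := le_antisymm (by omega) (hd u)
  obtain ⟨a, -, hua⟩ := exists_ne_adj hd u u
  obtain ⟨b, hba, eu⟩ := exists_neighborFinset_eq_pair du hua
  have hub : G.Adj u b := (adj_of_neighborFinset_eq eu).2 (.inr rfl)
  have ha3 : 3 ≤ G.degree a := lt_of_le_of_ne (hd a) (hno u a hua du).symm
  have hb3 : 3 ≤ G.degree b := lt_of_le_of_ne (hd b) (hno u b hub du).symm
  have gu := excess_pos hd hM u
  rw [excess_eq_of_neighborFinset hba eu] at gu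
  have ga := twelve_mul_excess_le hd hM hno a
  have gb := twelve_mul_excess_le hd hM hno b
  have pa := excess_pos hd hM a
  have pb := excess_pos hd hM b
  have hs := sq_commonWeight_le hM hba.symm
  have hc := le_commonWeight hua.symm hub.symm
  rw [du] at hc
  push_cast at hc
  -- The minor on the two neighbours a, b of u gives 1/4 ≤ excess a * excess b, and 144/4 = 36.
  have h1 : (36 : ℝ) ≤ ((G.degree a : ℝ) + 2) * ((G.degree b : ℝ) + 2) := by nlinarith
  have h2 : 36 ≤ (G.degree a + 2) * (G.degree b + 2) := by exact_mod_cast h1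
  have ha0 : (0 : ℝ) < G.degree a := by positivity
  have hb0 : (0 : ℝ) < G.degree b := by positivity
  -- Positivity of the excess of u, 1/deg a + 1/deg b > 1/2, with denominators cleared.
  have h3 : (G.degree a : ℝ) * G.degree b < 2 * (G.degree a + G.degree b) := by
    field_simp at gu
    nlinarith
  have h4 : G.degree a * G.degree b < 2 * (G.degree a + G.degree b) := by exact_mod_cast h3
  generalize G.degree a = p at *
  generalize G.degree b = q at *
  -- Now (p - 2)(q - 2) < 4 with p, q ≥ 3, so up to order only (3,3), (3,4), (3,5) remain, where (p
  -- + 2)(q + 2) ≤ 35.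
  have hp : p ≤ 5 := by by_contra! h; nlinarith
  have hq : q ≤ 5 := by by_contra! h; nlinarith
  interval_cases p <;> interval_cases q <;> omega

/-- Positive excess gives every vertex a neighbour of degree 3, so some adjacent w, u both have
degree 3. The minors push the other two neighbours of w to degree at least 6, making the excess of w
at most 1/12 - 2/12. -/
theorem not_three_le_degree [Nonempty V] : ¬ ∀ v, 3 ≤ G.degree v := by
  intro h3
  have h3' : ∀ v, 1 / (G.degree v : ℝ) ≤ 1 / 3 := fun v => by
    have : (3 : ℝ) ≤ G.degree v := by exact_mod_cast h3 v
    gcongr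
  have hle : ∀ v, 12 * excess G v ≤ G.degree v := by
    intro v
    have : excess G v ≤ ∑ w ∈ G.neighborFinset v, (1 / 12 : ℝ) :=
      Finset.sum_le_sum fun w _ => by linarith [h3' w]
    rw [Finset.sum_const, nsmul_eq_mul, ← degree_eq_card] at this
    linarith
  have hex : ∀ v, ∃ w, G.Adj v w ∧ G.degree w = 3 := by
    intro v
    by_contra! hne
    have : excess G v ≤ 0 := by
      refine Finset.sum_nonpos fun w hw => ?_
      have hw' : G.Adj v w := by simpa using hw
      have : (4 : ℝ) ≤ G.degree w := by
        exact_mod_cast lt_of_le_of_ne (h3 w) (hne w hw').symm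
      have : 1 / (G.degree w : ℝ) ≤ 1 / 4 := by gcongr
      linarith
    linarith [excess_pos hd hM v]
  obtain ⟨w, -, dw⟩ := hex (Classical.arbitrary V)
  obtain ⟨u, hwu, du⟩ := hex w
  have hlarge : ∀ x, G.Adj w x → x ≠ u → 1 / (G.degree x : ℝ) ≤ 1 / 6 := by
    intro x hx hxu
    have hs := sq_commonWeight_le hM hxu.symm
    have hc := le_commonWeight hwu.symm hx.symm
    have gu := hle u
    have gx := hle x
    have px := excess_pos hd hM x
    rw [dw] at hc
    rw [du] at gu
    push_cast at hc gu
    -- The minor on u, x reads 1/9 ≤ (3/12)(deg x/12).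
    have h1 : (16 : ℝ) ≤ 3 * G.degree x := by nlinarith
    have h2 : 16 ≤ 3 * G.degree x := by exact_mod_cast h1
    have h6 : (6 : ℝ) ≤ G.degree x := by exact_mod_cast (by omega : 6 ≤ G.degree x)
    gcongr
  have hmem : u ∈ G.neighborFinset w := by simpa using hwu
  have hpos := excess_pos hd hM w
  rw [excess, ← Finset.add_sum_erase _ _ hmem, du] at hpos
  have hsum : ∑ x ∈ (G.neighborFinset w).erase u, (1 / (G.degree x : ℝ) - 1 / 4) ≤
      ∑ x ∈ (G.neighborFinset w).erase u, (-(1 / 12) : ℝ) := by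
    refine Finset.sum_le_sum fun x hx => ?_
    rw [Finset.mem_erase, SimpleGraph.mem_neighborFinset] at hx
    linarith [hlarge x hx.2 hx.1]
  rw [Finset.sum_const, Finset.card_erase_of_mem hmem, ← degree_eq_card, dw] at hsum
  norm_num at hsum hpos
  linarith

theorem exists_adj_degree_two [Nonempty V] :
    ∃ u v, G.Adj u v ∧ G.degree u = 2 ∧ G.degree v = 2 := by
  by_contra! h
  exact not_three_le_degree hd hM (three_le_degree hd hM h)

/-- There is a vertex all of whose neighbours have degree two. -/
theorem exists_hub [Nonempty V] : ∃ w, ∀ x, G.Adj w x → G.degree x = 2 := by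
  obtain ⟨u, v, huv, du, dv⟩ := exists_adj_degree_two hd hM
  obtain ⟨w, hw, eu⟩ := exists_neighborFinset_eq_pair du huv
  obtain ⟨z, hz, ev⟩ := exists_neighborFinset_eq_pair dv huv.symm
  exact ⟨w, (path_ends hd hM hw.symm hz (by rw [eu, Finset.pair_comm]) ev).2.1⟩

end LocalStructure

/-! ### From the local structure to friendship and book graphs. -/

section Classification

open scoped Classical

variable {V : Type u} [Fintype V] {G : SimpleGraph V}

omit [Fintype V] in
theorem forall_of_connected_of_closed (hc : G.Connected) {S : V → Prop} {w : V} (hw : S w)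
    (hS : ∀ x y, G.Adj x y → S x → S y) (x : V) : S x := by
  obtain ⟨p⟩ := hc.preconnected w x
  induction p with
  | nil => exact hw
  | cons h _ ih => exact ih (hS _ _ h hw)

/-- In an arbitrary numbering, the smaller element of each orbit serves as its `false`
representative. -/
theorem exists_pairing {α : Type*} [Fintype α] (σ : α → α) (hσ : Function.Involutive σ)
    (hne : ∀ a, σ a ≠ a) :
    ∃ (m : ℕ) (e : Fin m × Bool ≃ α), ∀ i b, e (i, !b) = σ (e (i, b)) := by
  let φ := Fintype.equivFin α
  let S := {a : α // φ a < φ (σ a)}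
  let k : Fin (Fintype.card S) ≃ S := (Fintype.equivFin S).symm
  have hlt : ∀ a, φ a < φ (σ a) ∨ φ (σ a) < φ (σ (σ a)) := fun a => by
    rw [hσ a]
    exact lt_or_gt_of_ne fun h => hne a (φ.injective h).symm
  have hS : ∀ a b : S, σ a ≠ b := by
    rintro ⟨a, ha⟩ ⟨b, hb⟩ rfl
    rw [hσ a] at hb
    exact lt_asymm ha hb
  refine ⟨Fintype.card S, Equiv.ofBijective
    (fun p => if p.2 then σ (k p.1).1 else (k p.1).1) ⟨?_, ?_⟩, ?_⟩
  · rintro ⟨i, _ | _⟩ ⟨j, _ | _⟩ h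
    · simpa [Subtype.val_inj] using h
    · exact absurd h.symm (hS _ _)
    · exact absurd h (hS _ _)
    · simpa [Subtype.val_inj, hσ.injective.eq_iff] using h
  · intro a
    rcases hlt a with h | h
    · exact ⟨(k.symm ⟨a, h⟩, false), by simp⟩
    · exact ⟨(k.symm ⟨σ a, h⟩, true), by simpa using hσ a⟩
  · rintro i (_ | _)
    · rfl
    · exact (hσ _).symm

/-- A connected graph with a vertex all of whose neighbours are adjacent to exactly one other
neighbour of it and to nothing else is a friendship graph. -/
theorem friendship_of_hub (hc : G.Connected) {w x₀ : V} (hx₀ : G.Adj w x₀) (σ : V → V)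
    (hne : ∀ u, G.Adj w u → σ u ≠ w) (hN : ∀ u, G.Adj w u → G.neighborFinset u = {w, σ u})
    (hσ : ∀ u, G.Adj w u → G.Adj w (σ u)) :
    ∃ m, 1 ≤ m ∧ Nonempty (G ≃g friendshipGraph m) := by
  have hadj : ∀ u, G.Adj w u → ∀ x, G.Adj u x ↔ x = w ∨ x = σ u := fun u hu x =>
    adj_of_neighborFinset_eq (hN u hu)
  have hinv : ∀ u, G.Adj w u → σ (σ u) = u := by
    intro u hu
    have h := ((hadj u hu _).2 (.inr rfl)).symm
    rcases (hadj _ (hσ u hu) u).1 h with h | h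
    · exact absurd h hu.ne'
    · exact h.symm
  have hfix : ∀ u, G.Adj w u → σ u ≠ u := fun u hu h =>
    G.loopless.irrefl u ((hadj u hu u).2 (.inr h.symm))
  obtain ⟨m, e, he⟩ := exists_pairing (fun u : {u // G.Adj w u} => ⟨σ u.1, hσ u.1 u.2⟩)
    (fun u => Subtype.ext (hinv u.1 u.2)) (fun u h => hfix u.1 u.2 (congrArg Subtype.val h))
  have hall : ∀ x, x = w ∨ G.Adj w x := by
    refine forall_of_connected_of_closed hc (w := w) (.inl rfl) ?_
    rintro x y hxy (rfl | hx)
    · exact .inr hxy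
    · rcases (hadj x hx y).1 hxy with rfl | rfl
      · exact .inl rfl
      · exact .inr (hσ x hx)
  let φ : Option (Fin m × Bool) → V := fun o => o.elim w fun p => (e p).1
  have hφ : Function.Bijective φ := by
    constructor
    · rintro (_ | p) (_ | q) h
      · rfl
      · exact absurd h (e q).2.ne
      · exact absurd h (e p).2.ne'
      · exact congrArg some (e.injective (Subtype.ext h))
    · intro x
      rcases hall x with rfl | hx
      · exact ⟨none, rfl⟩
      · exact ⟨some (e.symm ⟨x, hx⟩), by simp [φ]⟩
  refine ⟨m, ?_, ⟨(RelIso.mk (Equiv.ofBijective φ hφ) ?_).symm⟩⟩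
  · exact Nat.one_le_iff_ne_zero.2 fun h => by
      subst h
      exact (e.symm ⟨x₀, hx₀⟩).1.elim0
  · intro a b
    change G.Adj (φ a) (φ b) ↔ _
    rcases a with _ | p <;> rcases b with _ | ⟨j, c⟩
    · exact iff_of_false (G.loopless.irrefl w) id
    · exact iff_of_true (e (j, c)).2 trivial
    · exact iff_of_true (e p).2.symm trivial
    · obtain ⟨i, b⟩ := p
      change G.Adj (e (i, b)).1 (e (j, c)).1 ↔ i = j ∧ b ≠ c
      rw [hadj _ (e (i, b)).2, or_iff_right (e (j, c)).2.ne',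
        ← Subtype.ext_iff (a1 := e (j, c)) (a2 := ⟨σ (e (i, b)).1, hσ _ (e (i, b)).2⟩),
        ← he, e.injective.eq_iff, Prod.mk.injEq, eq_comm (a := j)]
      cases b <;> cases c <;> simp

/-- A connected graph with two hubs whose neighbours are matched to each other and adjacent to
nothing else is a book graph. -/
theorem book_of_hubs (hc : G.Connected) {w z : V} (hw : 2 ≤ G.degree w) (hzw : z ≠ w)
    (hnwz : ¬ G.Adj w z) (σ : V → V)
    (hN : ∀ u, G.Adj w u → G.neighborFinset u = {w, σ u})
    (hσN : ∀ u, G.Adj w u → G.neighborFinset (σ u) = {u, z})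
    (hz : ∀ x, G.Adj z x ↔ ∃ u, G.Adj w u ∧ σ u = x) :
    ∃ m, 2 ≤ m ∧ Nonempty (G ≃g bookGraph m) := by
  have hadj : ∀ u, G.Adj w u → ∀ x, G.Adj u x ↔ x = w ∨ x = σ u := fun u hu x =>
    adj_of_neighborFinset_eq (hN u hu)
  have hadj' : ∀ u, G.Adj w u → ∀ x, G.Adj (σ u) x ↔ x = u ∨ x = z := fun u hu x =>
    adj_of_neighborFinset_eq (hσN u hu)
  have hnadj : ∀ u, G.Adj w u → ¬ G.Adj w (σ u) := by
    intro u hu h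
    rcases (hadj' u hu w).1 h.symm with h | h
    · exact hu.ne h
    · exact hzw h.symm
  have hσw : ∀ u, G.Adj w u → σ u ≠ w := by
    intro u hu h
    exact hnwz (h ▸ (hadj' u hu z).2 (.inr rfl))
  have hσz : ∀ u, G.Adj w u → σ u ≠ z := by
    intro u hu h
    exact G.loopless.irrefl z (by have := (hadj' u hu z).2 (.inr rfl); rwa [h] at this)
  have hinj : ∀ u v, G.Adj w u → G.Adj w v → σ u = σ v → u = v := by
    intro u v hu hv h
    rcases (hadj' v hv u).1 (h ▸ (hadj' u hu u).2 (.inl rfl)) with h | rfl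
    · exact h
    · exact absurd hu hnwz
  have huz : ∀ u, G.Adj w u → u ≠ z := by
    rintro u hu rfl
    exact hnwz hu
  have hall : ∀ x, x = w ∨ x = z ∨ G.Adj w x ∨ ∃ u, G.Adj w u ∧ σ u = x := by
    refine forall_of_connected_of_closed hc (w := w) (.inl rfl) ?_
    rintro x y hxy (rfl | rfl | hx | ⟨u, hu, rfl⟩)
    · exact .inr (.inr (.inl hxy))
    · exact .inr (.inr (.inr ((hz y).1 hxy)))
    · rcases (hadj x hx y).1 hxy with rfl | rfl
      · exact .inl rfl
      · exact .inr (.inr (.inr ⟨x, hx, rfl⟩))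
    · rcases (hadj' u hu y).1 hxy with rfl | rfl
      · exact .inr (.inr (.inl hu))
      · exact .inr (.inl rfl)
  have hcard : Fintype.card {u // G.Adj w u} = G.degree w := by
    rw [degree_eq_card, Fintype.card_subtype, SimpleGraph.neighborFinset_eq_filter]
  let e : Fin (G.degree w) ≃ {u // G.Adj w u} := (Fintype.equivFinOfCardEq hcard).symm
  have he : ∀ i, G.Adj w (e i).1 := fun i => (e i).2
  have hei : ∀ i j, (e i).1 = (e j).1 ↔ i = j := fun i j => by
    rw [Subtype.val_inj, e.injective.eq_iff]
  let φ : Bool ⊕ (Fin (G.degree w) × Bool) → V := fun o =>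
    o.elim (fun s => if s then z else w) fun p => if p.2 then σ (e p.1).1 else (e p.1).1
  have hφ : Function.Bijective φ := by
    constructor
    · rintro ((_ | _) | ⟨i, _ | _⟩) ((_ | _) | ⟨j, _ | _⟩) h
      · rfl
      · exact absurd h hzw.symm
      · exact absurd h (he j).ne
      · exact absurd h.symm (hσw _ (he j))
      · exact absurd h hzw
      · rfl
      · exact absurd h.symm (huz _ (he j))
      · exact absurd h.symm (hσz _ (he j))
      · exact absurd h (he i).ne'
      · exact absurd h (huz _ (he i))
      · rw [(hei i j).1 h]
      · exact absurd (he i) (by rw [show (e i).1 = _ from h]; exact hnadj _ (he j))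
      · exact absurd h (hσw _ (he i))
      · exact absurd h (hσz _ (he i))
      · exact absurd (he j) (by rw [← show _ = (e j).1 from h]; exact hnadj _ (he i))
      · rw [(hei i j).1 (hinj _ _ (he i) (he j) h)]
    · intro x
      rcases hall x with rfl | rfl | hx | ⟨u, hu, rfl⟩
      · exact ⟨.inl false, rfl⟩
      · exact ⟨.inl true, rfl⟩
      · exact ⟨.inr (e.symm ⟨x, hx⟩, false), by simp [φ]⟩
      · exact ⟨.inr (e.symm ⟨u, hu⟩, true), by simp [φ]⟩
  have hzσ : ∀ i, G.Adj z (σ (e i).1) := fun i => (hz _).2 ⟨_, he i, rfl⟩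
  have hze : ∀ i, ¬ G.Adj z (e i).1 := fun i h => by
    obtain ⟨u, hu, h⟩ := (hz _).1 h
    exact hnadj u hu (h ▸ he i)
  have hee : ∀ i j, ¬ G.Adj (e i).1 (e j).1 := fun i j h => by
    rcases (hadj _ (he i) _).1 h with h | h
    · exact (he j).ne' h
    · exact hnadj _ (he i) (h ▸ he j)
  have heσ : ∀ i j, G.Adj (e i).1 (σ (e j).1) ↔ i = j := fun i j => by
    rw [hadj _ (he i), or_iff_right (hσw _ (he j))]
    constructor
    · intro h
      exact ((hei _ _).1 (hinj _ _ (he j) (he i) h)).symm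
    · rintro rfl; rfl
  have hσσ : ∀ i j, ¬ G.Adj (σ (e i).1) (σ (e j).1) := fun i j h => by
    rcases (hadj' _ (he i) _).1 h with h | h
    · exact hnadj _ (he j) (h ▸ he i)
    · exact hσz _ (he j) h
  refine ⟨G.degree w, hw, ⟨(RelIso.mk (Equiv.ofBijective φ hφ) ?_).symm⟩⟩
  intro a b
  change G.Adj (φ a) (φ b) ↔ _
  have hnzw : ¬ G.Adj z w := fun h => hnwz h.symm
  have hez : ∀ i, ¬ G.Adj (e i).1 z := fun i h => hze i h.symm
  have hσe : ∀ i, ¬ G.Adj (σ (e i).1) w := fun i h => hnadj _ (he i) h.symm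
  have hσe' : ∀ i j, G.Adj (σ (e i).1) (e j).1 ↔ i = j := fun i j => by
    rw [G.adj_comm, heσ, eq_comm]
  rcases a with (_ | _) | ⟨i, _ | _⟩ <;> rcases b with (_ | _) | ⟨j, _ | _⟩ <;>
    simp [φ, bookGraph, hnwz, he, hnadj, hzσ, hze, hee, heσ, hσσ, (he _).symm, (hzσ _).symm,
      hnzw, hez, hσe, hσe']

/-- The classification of the graphs whose gap is large. -/
theorem friendship_or_book (hc : G.Connected) (hd : ∀ v, 2 ≤ G.degree v)
    (hM : (excessMatrix G).PosSemidef) :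
    (∃ m : ℕ, 1 ≤ m ∧ Nonempty (G ≃g friendshipGraph m)) ∨
      ∃ m : ℕ, 2 ≤ m ∧ Nonempty (G ≃g bookGraph m) := by
  have := hc.nonempty
  obtain ⟨w, hw⟩ := exists_hub hd hM
  have hex : ∀ u, ∃ x, G.Adj w u → x ≠ w ∧ G.neighborFinset u = {w, x} := by
    intro u
    by_cases hu : G.Adj w u
    · obtain ⟨x, hx⟩ := exists_neighborFinset_eq_pair (hw u hu) hu.symm
      exact ⟨x, fun _ => hx⟩
    -- The value off the neighbourhood of w is arbitrary; on it, σ u is the neighbour of u other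
    -- than w.
    · exact ⟨w, fun h => absurd h hu⟩
  choose σ hσ using hex
  have hne := fun u hu => (hσ u hu).1
  have hN := fun u hu => (hσ u hu).2
  have hpair : ∀ u v, G.Adj w u → G.Adj w v → u ≠ v → _ := fun u v hu hv huv =>
    equality_of_two_neighbors hd hM huv (hne u hu) (hne v hv) (hN u hu) (hN v hv)
  have hσ2 : ∀ u, G.Adj w u → G.degree (σ u) = 2 := by
    intro u hu
    obtain ⟨v, hvu, hv⟩ := exists_ne_adj hd w u
    exact (hpair u v hu hv hvu.symm).1
  have hinj : ∀ u v, G.Adj w u → G.Adj w v → σ u = σ v → u = v := by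
    intro u v hu hv h
    by_contra huv
    exact (hpair u v hu hv huv).2.2.1 h
  have huσ : ∀ u, G.Adj w u → G.Adj u (σ u) := fun u hu =>
    (adj_of_neighborFinset_eq (hN u hu)).2 (.inr rfl)
  by_cases hall : ∀ u, G.Adj w u → G.Adj w (σ u)
  · obtain ⟨x₀, -, hx₀⟩ := exists_ne_adj hd w w
    exact .inl (friendship_of_hub hc hx₀ σ hne hN hall)
  right
  push Not at hall
  obtain ⟨u, hu, hnu⟩ := hall
  obtain ⟨z, hzu, hNu'⟩ := exists_neighborFinset_eq_pair (hσ2 u hu) (huσ u hu).symm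
  have hu'z : G.Adj (σ u) z := (adj_of_neighborFinset_eq hNu').2 (.inr rfl)
  have hzw : z ≠ w := by
    rintro rfl
    exact hnu hu'z.symm
  -- Were z a neighbour of w, then σ u, a neighbour of z other than w, would be σ z, against
  -- injectivity.
  have hzv : ∀ v, G.Adj w v → z ≠ v := by
    rintro v hv rfl
    rcases (adj_of_neighborFinset_eq (hN z hv)).1 hu'z.symm with h | h
    · exact hne u hu h
    · exact hzu (hinj u z hu hv h).symm
  have hnwz : ¬ G.Adj w z := fun h => hzv z h rfl
  have hσz : ∀ v, G.Adj w v → G.Adj (σ v) z := by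
    intro v hv
    by_cases huv : u = v
    · exact huv ▸ hu'z
    obtain ⟨-, -, -, gu, gv⟩ := hpair u v hu hv huv
    -- z shares the neighbour σ u with u, so it must also share one with v; as w is not adjacent to
    -- z, it is σ v.
    have heq := commonWeight_eq_of_excess_eq hM huv gu gv hzu (hzv v hv)
    have hpos : 0 < commonWeight G z v := by
      rw [← heq]
      exact (one_div_degree_pos hd _).trans_le (le_commonWeight hu'z.symm (huσ u hu))
    obtain ⟨x, hx, -⟩ := Finset.exists_ne_zero_of_sum_ne_zero hpos.ne'
    simp only [Finset.mem_inter, SimpleGraph.mem_neighborFinset] at hx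
    rcases (adj_of_neighborFinset_eq (hN v hv)).1 hx.2 with rfl | rfl
    · exact absurd hx.1.symm hnwz
    · exact hx.1.symm
  have hσN : ∀ v, G.Adj w v → G.neighborFinset (σ v) = {v, z} := by
    intro v hv
    obtain ⟨x, hxv, hx⟩ := exists_neighborFinset_eq_pair (hσ2 v hv) (huσ v hv).symm
    rcases (adj_of_neighborFinset_eq hx).1 (hσz v hv) with h | h
    · exact absurd h (hzv v hv)
    · rw [hx, h]
  have hdeg := (path_ends hd hM (hne u hu) hzu (hN u hu) hNu').1
  -- σ injects the neighbours of w into those of z, and the degrees agree by `path_ends`, so z has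
  -- no further neighbours.
  have himage : (G.neighborFinset w).image σ = G.neighborFinset z := by
    refine Finset.eq_of_subset_of_card_le ?_ ?_
    · intro x hx
      obtain ⟨v, hv, rfl⟩ := Finset.mem_image.1 hx
      rw [SimpleGraph.mem_neighborFinset] at hv ⊢
      exact (hσz v hv).symm
    · rw [Finset.card_image_of_injOn, ← degree_eq_card, ← degree_eq_card, hdeg]
      intro a ha b hb
      simp only [Finset.mem_coe, SimpleGraph.mem_neighborFinset] at ha hb
      exact hinj a b ha hb
  refine book_of_hubs hc (hd w) hzw hnwz σ hN hσN fun x => ?_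
  rw [← SimpleGraph.mem_neighborFinset, ← himage]
  simp

end Classification

/-! ### Spectra of friendship and book graphs. -/

section Models

open scoped Classical

theorem sum_neighborFinset {V : Type*} [Fintype V] (G : SimpleGraph V) (f : V → ℝ) (v : V) :
    ∑ w ∈ G.neighborFinset v, f w = ∑ w, if G.Adj v w then f w else 0 := by
  rw [SimpleGraph.neighborFinset_eq_filter, Finset.sum_filter]

theorem degree_eq_sum {V : Type*} [Fintype V] (G : SimpleGraph V) (v : V) :
    (G.degree v : ℝ) = ∑ _w ∈ G.neighborFinset v, 1 := by
  simp

variable {m : ℕ}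

theorem friendship_sum_none (f : Option (Fin m × Bool) → ℝ) :
    ∑ w ∈ (friendshipGraph m).neighborFinset none, f w =
      ∑ i, (f (some (i, false)) + f (some (i, true))) := by
  rw [sum_neighborFinset, Fintype.sum_option, Fintype.sum_prod_type]
  simp [friendshipGraph, add_comm]

theorem friendship_sum_some (f : Option (Fin m × Bool) → ℝ) (i : Fin m) (b : Bool) :
    ∑ w ∈ (friendshipGraph m).neighborFinset (some (i, b)), f w =
      f none + f (some (i, !b)) := by
  rw [sum_neighborFinset, Fintype.sum_option, Fintype.sum_prod_type]
  cases b <;> simp [friendshipGraph, ite_and]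

theorem book_sum_inl (f : Bool ⊕ (Fin m × Bool) → ℝ) (s : Bool) :
    ∑ w ∈ (bookGraph m).neighborFinset (.inl s), f w = ∑ i, f (.inr (i, s)) := by
  rw [sum_neighborFinset, Fintype.sum_sum_type, Fintype.sum_prod_type]
  cases s <;> simp [bookGraph]

theorem book_sum_inr (f : Bool ⊕ (Fin m × Bool) → ℝ) (i : Fin m) (b : Bool) :
    ∑ w ∈ (bookGraph m).neighborFinset (.inr (i, b)), f w =
      f (.inl b) + f (.inr (i, !b)) := by
  rw [sum_neighborFinset, Fintype.sum_sum_type, Fintype.sum_prod_type]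
  cases b <;> simp [bookGraph, ite_and]

theorem friendship_degree_none : (friendshipGraph m).degree none = 2 * m := by
  have := degree_eq_sum (friendshipGraph m) none
  rw [friendship_sum_none] at this
  rw [← Nat.cast_inj (R := ℝ), this]
  norm_num [mul_comm]

theorem friendship_degree_some (p : Fin m × Bool) :
    (friendshipGraph m).degree (some p) = 2 := by
  have := degree_eq_sum (friendshipGraph m) (some p)
  rw [friendship_sum_some] at this
  rw [← Nat.cast_inj (R := ℝ), this]
  norm_num

theorem book_degree_inl (s : Bool) : (bookGraph m).degree (.inl s) = m := by
  have := degree_eq_sum (bookGraph m) (.inl s)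
  rw [book_sum_inl] at this
  rw [← Nat.cast_inj (R := ℝ), this]
  simp

theorem book_degree_inr (p : Fin m × Bool) : (bookGraph m).degree (.inr p) = 2 := by
  have := degree_eq_sum (bookGraph m) (.inr p)
  rw [book_sum_inr] at this
  rw [← Nat.cast_inj (R := ℝ), this]
  norm_num

theorem friendship_two_le_degree (hm : 1 ≤ m) (v) : 2 ≤ (friendshipGraph m).degree v := by
  rcases v with _ | p
  · rw [friendship_degree_none]; omega
  · rw [friendship_degree_some]

theorem book_two_le_degree (hm : 2 ≤ m) (v) : 2 ≤ (bookGraph m).degree v := by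
  rcases v with s | p
  · rw [book_degree_inl]; exact hm
  · rw [book_degree_inr]

theorem friendship_connected : (friendshipGraph m).Connected := by
  have : ∀ v, (friendshipGraph m).Reachable none v := by
    rintro (_ | p)
    · rfl
    · exact SimpleGraph.Adj.reachable (G := friendshipGraph m) trivial
  exact { preconnected := fun u v => (this u).symm.trans (this v), nonempty := ⟨none⟩ }

theorem book_connected (hm : 1 ≤ m) : (bookGraph m).Connected := by
  have h1 : ∀ p : Fin m × Bool, (bookGraph m).Reachable (.inl p.2) (.inr p) := fun p =>
    SimpleGraph.Adj.reachable (G := bookGraph m) (show p.2 = p.2 from rfl)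
  have h2 : ∀ i : Fin m, (bookGraph m).Reachable (.inr (i, false)) (.inr (i, true)) := fun i =>
    SimpleGraph.Adj.reachable (G := bookGraph m)
      (show i = i ∧ false ≠ true from ⟨rfl, Bool.false_ne_true⟩)
  have h3 : (bookGraph m).Reachable (.inl false) (.inl true) :=
    ((h1 (⟨0, hm⟩, false)).trans (h2 _)).trans (h1 (⟨0, hm⟩, true)).symm
  have : ∀ v, (bookGraph m).Reachable (.inl false) v := by
    rintro ((_ | _) | ⟨i, _ | _⟩)
    · rfl
    · exact h3
    · exact h1 (i, false)
    · exact h3.trans (h1 (i, true))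
  exact { preconnected := fun u v => (this u).symm.trans (this v), nonempty := ⟨.inl false⟩ }

theorem half_le_abs_of_eq {κ : ℝ} (h : κ = 1 / 2 ∨ κ = -1 / 2 ∨ κ = 1 ∨ κ = -1) :
    1 / 2 ≤ |κ| := by
  rcases h with rfl | rfl | rfl | rfl <;> norm_num [abs_of_neg]

/-- The eigenvalue equation of a star of `m` rays: it appears for the functions on a friendship
graph that agree on each triangle, and for (anti)symmetric functions on a book graph. -/
theorem star_eigenvalue (hm : 1 ≤ m) {κ c : ℝ} {a : Fin m → ℝ} (ha : ∀ i, c + a i = 2 * κ * a i)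
    (hc : ∑ i, a i = κ * m * c) : κ = 1 / 2 ∨ κ = -1 / 2 ∨ κ = 1 ∨ (c = 0 ∧ ∀ i, a i = 0) := by
  by_cases h : κ = 1 / 2
  · exact .inl h
  right
  have h' : 2 * κ - 1 ≠ 0 := fun h0 => h (by linarith)
  have hai : ∀ i, a i = c / (2 * κ - 1) := fun i => by
    rw [eq_div_iff h']
    linarith [ha i]
  have hm' : (m : ℝ) ≠ 0 := by positivity
  simp only [hai, Finset.sum_const, Finset.card_univ, Fintype.card_fin, nsmul_eq_mul] at hc
  field_simp at hc
  -- Substituting a i = c/(2κ - 1) into the centre equation leaves c(2κ² - κ - 1) = 0.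
  have h0 : c * ((2 * κ + 1) * (κ - 1)) = 0 := by linarith
  rcases mul_eq_zero.1 h0 with h0 | h0
  · exact .inr (.inr ⟨h0, fun i => by rw [hai, h0, zero_div]⟩)
  · rcases mul_eq_zero.1 h0 with h0 | h0
    · exact .inl (by linarith)
    · exact .inr (.inl (by linarith))

theorem gap_friendshipGraph (hm : 1 ≤ m) : gap (friendshipGraph m) = 1 / 2 := by
  have hd : ∀ v, 0 < (friendshipGraph m).degree v := fun v =>
    two_pos.trans_le (friendship_two_le_degree hm v)
  apply le_antisymm
  · let i₀ : Fin m := ⟨0, hm⟩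
    -- Antisymmetric on one triangle and zero elsewhere: an eigenfunction for -1/2.
    let f : Option (Fin m × Bool) → ℝ := fun o => o.elim 0 fun p =>
      if p.1 = i₀ then (if p.2 then 1 else -1) else 0
    refine (gap_le_of_isWalkEigen hd (κ := -1 / 2) (f := f) ⟨?_, ?_⟩).trans ?_
    · intro h
      simpa [f] using congrFun h (some (i₀, true))
    · rintro (_ | ⟨i, b⟩)
      · rw [friendship_sum_none]
        simp only [f, Option.elim]
        rw [mul_zero]
        refine Finset.sum_eq_zero fun i _ => ?_
        by_cases hi : i = i₀ <;> simp [hi]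
      · rw [friendship_sum_some, friendship_degree_some]
        by_cases hi : i = i₀ <;> cases b <;> simp [f, hi]
    · norm_num [abs_of_neg]
  · rw [le_gap_iff hd]
    rintro κ f ⟨hf0, hf⟩
    apply half_le_abs_of_eq
    have hc := hf none
    have hi : ∀ i b, f none + f (some (i, !b)) = 2 * κ * f (some (i, b)) := fun i b => by
      rw [← friendship_sum_some, hf, friendship_degree_some]
      push_cast; ring
    rw [friendship_sum_none, friendship_degree_none] at hc
    by_cases hκ : κ = -1 / 2
    · exact .inr (.inl hκ)
    have heq : ∀ i, f (some (i, true)) = f (some (i, false)) := fun i => by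
      have h1 := hi i true
      have h2 := hi i false
      simp only [Bool.not_true, Bool.not_false] at h1 h2
      have h3 : (2 * κ + 1) * (f (some (i, true)) - f (some (i, false))) = 0 := by linarith
      rcases mul_eq_zero.1 h3 with h | h
      · exact absurd (by linarith) hκ
      · linarith
    have := star_eigenvalue (κ := κ) (c := f none) (a := fun i => f (some (i, false))) hm
      (fun i => by simpa [heq] using hi i false) (by
        simp only [heq, ← two_mul, ← Finset.mul_sum] at hc
        push_cast at hc
        linarith)
    rcases this with h | h | h | ⟨h0, h⟩
    · exact .inl h
    · exact .inr (.inl h)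
    · exact .inr (.inr (.inl h))
    · refine absurd ?_ hf0
      ext (_ | ⟨i, _ | _⟩)
      · exact h0
      · exact h i
      · exact (heq i).trans (h i)

theorem gap_bookGraph (hm : 2 ≤ m) : gap (bookGraph m) = 1 / 2 := by
  have hd : ∀ v, 0 < (bookGraph m).degree v := fun v =>
    two_pos.trans_le (book_two_le_degree hm v)
  apply le_antisymm
  · let i₀ : Fin m := ⟨0, by omega⟩
    let i₁ : Fin m := ⟨1, by omega⟩
    have h01 : i₁ ≠ i₀ := by simp [i₀, i₁]
    -- The difference of the indicators of two pages cancels at both hubs; this needs m ≥ 2.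
    let f : Bool ⊕ (Fin m × Bool) → ℝ := fun o => o.elim (fun _ => 0) fun p =>
      (if p.1 = i₀ then 1 else 0) - if p.1 = i₁ then 1 else 0
    refine (gap_le_of_isWalkEigen hd (κ := 1 / 2) (f := f) ⟨?_, ?_⟩).trans ?_
    · intro h
      simpa [f, h01.symm] using congrFun h (.inr (i₀, true))
    · rintro (s | ⟨i, b⟩)
      · rw [book_sum_inl]
        simp [f]
      · rw [book_sum_inr, book_degree_inr]
        simp [f]
    · norm_num
  · rw [le_gap_iff hd]
    rintro κ f ⟨hf0, hf⟩
    apply half_le_abs_of_eq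
    have hc : ∀ s, ∑ i, f (.inr (i, s)) = κ * m * f (.inl s) := fun s => by
      rw [← book_sum_inl, hf, book_degree_inl]
    have hi : ∀ i b, f (.inl b) + f (.inr (i, !b)) = 2 * κ * f (.inr (i, b)) := fun i b => by
      rw [← book_sum_inr, hf, book_degree_inr]
      push_cast; ring
    have hi' : ∀ i, _ ∧ _ := fun i => ⟨hi i false, hi i true⟩
    simp only [Bool.not_true, Bool.not_false] at hi'
    -- The reflection exchanging the hubs splits f: its symmetric part solves the star equations for
    -- κ, its antisymmetric part for -κ.
    have hs := star_eigenvalue (κ := κ) (c := f (.inl false) + f (.inl true))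
      (a := fun i => f (.inr (i, false)) + f (.inr (i, true))) (by omega)
      (fun i => by linarith [(hi' i).1, (hi' i).2])
      (by rw [Finset.sum_add_distrib, hc, hc]; ring)
    have ha := star_eigenvalue (κ := -κ) (c := f (.inl false) - f (.inl true))
      (a := fun i => f (.inr (i, true)) - f (.inr (i, false))) (by omega)
      (fun i => by linarith [(hi' i).1, (hi' i).2])
      (by rw [Finset.sum_sub_distrib, hc, hc]; ring)
    rcases hs with h | h | h | ⟨h0, h⟩
    · exact .inl h
    · exact .inr (.inl h)
    · exact .inr (.inr (.inl h))
    rcases ha with h' | h' | h' | ⟨h0', h'⟩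
    · exact .inr (.inl (by linarith))
    · exact .inl (by linarith)
    · exact .inr (.inr (.inr (by linarith)))
    · refine absurd ?_ hf0
      ext ((_ | _) | ⟨i, _ | _⟩)
      · simp only [Pi.zero_apply]; linarith
      · simp only [Pi.zero_apply]; linarith
      · simp only [Pi.zero_apply]; linarith [h i, h' i]
      · simp only [Pi.zero_apply]; linarith [h i, h' i]

theorem friendshipGraph_one_iso : Nonempty (friendshipGraph 1 ≃g SimpleGraph.cycleGraph 3) := by
  let φ : Option (Fin 1 × Bool) → Fin 3 := fun o => o.elim 0 fun p => if p.2 then 2 else 1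
  refine ⟨RelIso.mk (Equiv.ofBijective φ (by decide)) ?_⟩
  intro a b
  change (SimpleGraph.cycleGraph 3).Adj (φ a) (φ b) ↔ _
  rcases a with _ | ⟨i, _ | _⟩ <;> rcases b with _ | ⟨j, _ | _⟩ <;>
    (try fin_cases i) <;> (try fin_cases j) <;>
    simp [φ, friendshipGraph, SimpleGraph.cycleGraph_adj] <;> decide

theorem bookGraph_two_iso : Nonempty (bookGraph 2 ≃g SimpleGraph.cycleGraph 6) := by
  let φ : Bool ⊕ (Fin 2 × Bool) → Fin 6 := fun o => o.elim (fun s => if s then 3 else 0) fun p =>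
    if p.1 = 0 then (if p.2 then 2 else 1) else if p.2 then 4 else 5
  refine ⟨RelIso.mk (Equiv.ofBijective φ (by decide)) ?_⟩
  intro a b
  change (SimpleGraph.cycleGraph 6).Adj (φ a) (φ b) ↔ _
  rcases a with (_ | _) | ⟨i, _ | _⟩ <;> rcases b with (_ | _) | ⟨j, _ | _⟩ <;>
    (try fin_cases i) <;> (try fin_cases j) <;>
    simp [φ, bookGraph, SimpleGraph.cycleGraph_adj] <;> decide

end Models

/-! ### The supremum and the extremal graphs. -/

section Extremal

open scoped Classical

/-- The graphs that are claimed to be extremal among those of minimum degree two. -/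
def IsFriendshipOrBook (G : FinGraph.{u}) : Prop :=
  (∃ m : ℕ, 1 ≤ m ∧ Nonempty (G.graph ≃g friendshipGraph m)) ∨
    ∃ m : ℕ, 2 ≤ m ∧ Nonempty (G.graph ≃g bookGraph m)

theorem isFriendshipOrBook_of_half_le_gap {G : FinGraph.{u}} (hG : G ∈ minDegreeGE 2)
    (h : 1 / 2 ≤ gap G.graph) : IsFriendshipOrBook G := by
  obtain ⟨⟨hc, -⟩, hd⟩ := hG
  have := hc.nonempty
  refine friendship_or_book hc hd (excessMatrix_posSemidef fun f => ?_)
  have := sq_mul_sum_le_of_le_gap (fun v => two_pos.trans_le (hd v)) (by norm_num) h f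
  norm_num at this ⊢
  exact this

theorem mem_and_gap_eq_of_iso {G : FinGraph.{u}} {W : Type*} [Fintype W] {H : SimpleGraph W}
    (e : G.graph ≃g H) (hc : H.Connected) (hd : ∀ v, 2 ≤ H.degree v) :
    G ∈ minDegreeGE 2 ∧ gap G.graph = gap H := by
  have hcG : G.graph.Connected := e.connected_iff.2 hc
  have hdG : ∀ v, 2 ≤ G.graph.degree v := fun v => by
    have h : H.degree (e v) = G.graph.degree v := by convert e.degree_eq v
    exact h ▸ hd (e v)
  have := hcG.nonempty
  refine ⟨⟨⟨hcG, ?_⟩, hdG⟩, gap_congr e fun v => two_pos.trans_le (hdG v)⟩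
  -- A vertex of degree at least two already forces three vertices.
  exact (hdG (Classical.arbitrary _)).trans_lt (G.graph.degree_lt_card_verts _)

theorem IsFriendshipOrBook.mem_and_gap_eq {G : FinGraph.{u}} (h : IsFriendshipOrBook G) :
    G ∈ minDegreeGE 2 ∧ gap G.graph = 1 / 2 := by
  obtain ⟨m, hm, ⟨e⟩⟩ | ⟨m, hm, ⟨e⟩⟩ := h
  · rw [← gap_friendshipGraph hm]
    exact mem_and_gap_eq_of_iso e friendship_connected (friendship_two_le_degree hm)
  · rw [← gap_bookGraph hm]
    exact mem_and_gap_eq_of_iso e (book_connected (by omega)) (book_two_le_degree hm)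

/-- The classification needs only gap ≥ 1/2 and yields graphs of gap exactly 1/2, so it also gives
the upper bound. -/
theorem gap_le_half {G : FinGraph.{u}} (hG : G ∈ minDegreeGE 2) : gap G.graph ≤ 1 / 2 := by
  by_contra! h
  exact h.ne' (isFriendshipOrBook_of_half_le_gap hG h.le).mem_and_gap_eq.2

theorem gap_eq_half_iff {G : FinGraph.{u}} :
    G ∈ minDegreeGE 2 ∧ gap G.graph = 1 / 2 ↔ IsFriendshipOrBook G :=
  ⟨fun h => isFriendshipOrBook_of_half_le_gap h.1 h.2.ge, fun h => h.mem_and_gap_eq⟩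

theorem regularGraphs_subset (d : ℕ) : regularGraphs.{u} d ⊆ minDegreeGE d :=
  fun _ hG => ⟨hG.1, fun v => (hG.2 v).ge⟩

theorem mem_regularGraphs_and_isFriendshipOrBook_iff {G : FinGraph.{u}} :
    G ∈ regularGraphs 2 ∧ IsFriendshipOrBook G ↔
      Nonempty (G.graph ≃g SimpleGraph.cycleGraph 3) ∨
        Nonempty (G.graph ≃g SimpleGraph.cycleGraph 6) := by
  obtain ⟨e₃⟩ := friendshipGraph_one_iso
  obtain ⟨e₆⟩ := bookGraph_two_iso
  constructor
  · rintro ⟨⟨-, hd⟩, ⟨m, hm, ⟨e⟩⟩ | ⟨m, hm, ⟨e⟩⟩⟩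
    · have h : G.graph.degree (e.symm none) = (friendshipGraph m).degree none := by
        convert e.symm.degree_eq none
      rw [hd, friendship_degree_none] at h
      obtain rfl : m = 1 := by omega
      exact .inl ⟨e.trans e₃⟩
    · have h : G.graph.degree (e.symm (.inl false)) = (bookGraph m).degree (.inl false) := by
        convert e.symm.degree_eq (.inl false)
      rw [hd, book_degree_inl] at h
      subst h
      exact .inr ⟨e.trans e₆⟩
  · rintro (⟨⟨e⟩⟩ | ⟨⟨e⟩⟩)
    · have e' : G.graph ≃g friendshipGraph 1 := e.trans e₃.symm
      have hF : IsFriendshipOrBook G := .inl ⟨1, le_rfl, ⟨e'⟩⟩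
      refine ⟨⟨hF.mem_and_gap_eq.1.1, fun v => ?_⟩, hF⟩
      have h : (friendshipGraph 1).degree (e' v) = G.graph.degree v := by convert e'.degree_eq v
      rw [← h]
      rcases e' v with _ | p
      · exact friendship_degree_none
      · exact friendship_degree_some p
    · have e' : G.graph ≃g bookGraph 2 := e.trans e₆.symm
      have hF : IsFriendshipOrBook G := .inr ⟨2, le_rfl, ⟨e'⟩⟩
      refine ⟨⟨hF.mem_and_gap_eq.1.1, fun v => ?_⟩, hF⟩
      have h : (bookGraph 2).degree (e' v) = G.graph.degree v := by convert e'.degree_eq v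
      rw [← h]
      rcases e' v with s | p
      · exact book_degree_inl s
      · exact book_degree_inr p

theorem exists_triangle :
    ∃ G : FinGraph.{u}, Nonempty (G.graph ≃g SimpleGraph.cycleGraph 3) :=
  ⟨⟨ULift.{u} (Fin 3), (SimpleGraph.cycleGraph 3).comap Equiv.ulift⟩,
    ⟨SimpleGraph.Iso.comap Equiv.ulift _⟩⟩

/-- Both families lie in this range: the triangle attains the value, and the bound comes from the
larger family. -/
theorem isGreatest_gapValues {𝒢 : Set FinGraph.{u}} (h₁ : regularGraphs 2 ⊆ 𝒢)
    (h₂ : 𝒢 ⊆ minDegreeGE 2) : IsGreatest (gapValues 𝒢) (1 / 2) := by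
  obtain ⟨G, hG⟩ := exists_triangle.{u}
  obtain ⟨hG, hF⟩ := mem_regularGraphs_and_isFriendshipOrBook_iff.2 (.inl hG)
  refine ⟨⟨G, h₁ hG, hF.mem_and_gap_eq.2⟩, ?_⟩
  rintro _ ⟨H, hH, rfl⟩
  exact gap_le_half (h₂ hH)

end Extremal

end SpectralGap

theorem theorem5 :
    (IsLUB (SpectralGap.gapValues (SpectralGap.regularGraphs.{u} 2))
        (SpectralGap.supGap (SpectralGap.regularGraphs.{u} 2)) ∧
      SpectralGap.supGap (SpectralGap.regularGraphs.{u} 2) = 1 / 2) ∧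
    (IsLUB (SpectralGap.gapValues (SpectralGap.minDegreeGE.{u} 2))
        (SpectralGap.supGap (SpectralGap.minDegreeGE.{u} 2)) ∧
      SpectralGap.supGap (SpectralGap.minDegreeGE.{u} 2) = 1 / 2) ∧
    SpectralGap.extremalGraphs (SpectralGap.regularGraphs.{u} 2) =
      {G | Nonempty (G.graph ≃g SimpleGraph.cycleGraph 3) ∨
        Nonempty (G.graph ≃g SimpleGraph.cycleGraph 6)} ∧
    SpectralGap.extremalGraphs (SpectralGap.minDegreeGE.{u} 2) =
      {G | (∃ m : ℕ, 1 ≤ m ∧ Nonempty (G.graph ≃g SpectralGap.friendshipGraph m)) ∨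
        ∃ m : ℕ, 2 ≤ m ∧ Nonempty (G.graph ≃g SpectralGap.bookGraph m)} := by
  have hr := SpectralGap.isGreatest_gapValues.{u} subset_rfl (SpectralGap.regularGraphs_subset 2)
  have hm := SpectralGap.isGreatest_gapValues.{u} (SpectralGap.regularGraphs_subset 2) subset_rfl
  have hr' : SpectralGap.supGap (SpectralGap.regularGraphs.{u} 2) = 1 / 2 := hr.csSup_eq
  have hm' : SpectralGap.supGap (SpectralGap.minDegreeGE.{u} 2) = 1 / 2 := hm.csSup_eq
  refine ⟨⟨hr' ▸ hr.isLUB, hr'⟩, ⟨hm' ▸ hm.isLUB, hm'⟩, ?_, ?_⟩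
  · ext G
    rw [SpectralGap.extremalGraphs, hr', Set.mem_ofPred_eq, Set.mem_ofPred_eq,
      ← SpectralGap.mem_regularGraphs_and_isFriendshipOrBook_iff, ← SpectralGap.gap_eq_half_iff]
    exact ⟨fun h => ⟨h.1, SpectralGap.regularGraphs_subset 2 h.1, h.2⟩, fun h => ⟨h.1, h.2.2⟩⟩
  · ext G
    rw [SpectralGap.extremalGraphs, hm']
    exact SpectralGap.gap_eq_half_iff
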